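/- Let $\Sigma$ be a finite alphabet and let $L \subseteq \Sigma^*$ be a regular language. Then the dynamic membership problem $\mathrm{Member}(L)$ is in $\mathrm{UDyn}\Sigma_2$, which means the following. For $n \ge 0$, an input word with $n$ positions is a sequence $w = w_1 \cdots w_n$ with $w_i \in \Sigma \cup \{\epsilon\}$; it is encoded as a relational structure with domain $\{1,\dots,n\}$, the linear order $\le$ of the positions, and the unary relations $W_\sigma = \{ i : w_i = \sigma\}$ for $\sigma \in \Sigma$. A change $\mathrm{set}_\sigma(i)$, with $\sigma \in \Sigma\cup\{\epsilon\}$ and $1 \le i \le n$, replaces $w_i$ by $\sigma$. There are a finite schema of auxiliary relation symbols, each of arity $0$ or $1$, containing a distinguished $0$-ary symbol $q$; for each auxiliary symbol $R$ a first-order initialization formula over the schema $\{\le\} \cup \{W_\sigma : \sigma\in\Sigma\}$; and for each auxiliary symbol $R$ and each $\sigma \in \Sigma \cup \{\epsilon\}$ an update formula $\varphi^R_\sigma(\bar x; y)$ over the input and auxiliary symbols, where $\bar x$ has the arity of $R$, that is in prenex form with quantifier prefix $\exists^*\forall^*$, such that the following holds for every $n\ge 0$ (all these formulas being independent of $n$).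 Start with the word $w_0 = \epsilon^n$ and with the auxiliary relations defined on it by the initialization formulas. Apply any finite sequence of changes, where at each change $\mathrm{set}_\sigma(i)$ from $w$ to $w'$ every auxiliary relation $R$ is replaced by the set of all tuples $\bar a$ such that $\varphi^R_\sigma(\bar a; i)$ holds in the structure consisting of the new word $w'$ and the old auxiliary relations. Then the bit $q$ is true if and only if the current word, read as an element of $\Sigma^*$ by skipping the positions that carry $\epsilon$, belongs to $L$. -/

import Mathlib

universe u

namespace DynWord

/-- The relation symbols of the input schema over the alphabet `α`: a unary symbol `W_a` for every
letter `a`, and a binary symbol for the linear order of the positions. -/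
inductive InputRel (α : Type u) : ℕ → Type u
  | letter (a : α) : InputRel α 1
  | le : InputRel α 2

/-- The (purely relational) input schema. -/
abbrev inputSchema (α : Type u) : FirstOrder.Language.{0, u} :=
  ⟨fun _ => Empty, InputRel α⟩

/-- The relation symbols of the joint schema: the input relation symbols and the auxiliary relation
symbols, where `Aux k` is the type of `k`-ary auxiliary relation symbols. -/
inductive JointRel (α : Type u) (Aux : ℕ → Type) : ℕ → Type u
  | input {k : ℕ} (r : InputRel α k) : JointRel α Aux k
  | aux {k : ℕ} (R : Aux k) : JointRel α Aux k

/-- The (purely relational) joint schema of the input and the auxiliary relations. -/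
abbrev jointSchema (α : Type u) (Aux : ℕ → Type) : FirstOrder.Language.{0, u} :=
  ⟨fun _ => Empty, JointRel α Aux⟩

/-- An input word with `n` positions; every position carries a letter or `ε` (that is, `none`). -/
abbrev Word (α : Type u) (n : ℕ) : Type u := Fin n → Option α

/-- The string `w₁ ⋯ wₙ` over `α` encoded by `w`: positions that carry `ε` are skipped. -/
def Word.toList {α : Type u} {n : ℕ} (w : Word α n) : List α :=
  (List.ofFn w).reduceOption

/-- The meaning of the input relation symbols in the encoding of the input word `w`. -/
def InputRel.Holds {α : Type u} {n : ℕ} (w : Word α n) :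
    ∀ {k : ℕ}, InputRel α k → (Fin k → Fin n) → Prop
  | _, .letter a, x => w (x 0) = some a
  | _, .le, x => x 0 ≤ x 1

/-- The relational structure that encodes the input word `w`. -/
abbrev inputStructure {α : Type u} {n : ℕ} (w : Word α n) :
    (inputSchema α).Structure (Fin n) where
  funMap := fun f _ => nomatch f
  RelMap := fun r x => InputRel.Holds w r x

/-- An interpretation of the auxiliary relation symbols over the positions `Fin n`. -/
abbrev AuxInterp (Aux : ℕ → Type) (n : ℕ) : Type :=
  ∀ k : ℕ, Aux k → (Fin k → Fin n) → Prop

/-- The meaning of the relation symbols of the joint schema. -/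
def JointRel.Holds {α : Type u} {Aux : ℕ → Type} {n : ℕ} (w : Word α n) (A : AuxInterp Aux n) :
    ∀ {k : ℕ}, JointRel α Aux k → (Fin k → Fin n) → Prop
  | _, .input r, x => r.Holds w x
  | k, .aux R, x => A k R x

/-- The structure `(w, A)` over the joint schema. -/
abbrev jointStructure {α : Type u} {Aux : ℕ → Type} {n : ℕ} (w : Word α n)
    (A : AuxInterp Aux n) : (jointSchema α Aux).Structure (Fin n) where
  funMap := fun f _ => nomatch f
  RelMap := fun r x => JointRel.Holds w A r x

/-- `∃*∀*`-formulas in prenex form: a (possibly empty) block of existential quantifiers, followed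
by a (possibly empty) block of universal quantifiers, followed by a quantifier-free formula. -/
inductive IsSigma2 {S : FirstOrder.Language.{0, u}} {β : Type} :
    ∀ {n : ℕ}, S.BoundedFormula β n → Prop
  | of_isUniversal {n : ℕ} {φ : S.BoundedFormula β n} (h : φ.IsUniversal) : IsSigma2 φ
  | ex {n : ℕ} {φ : S.BoundedFormula β (n + 1)} (h : IsSigma2 φ) : IsSigma2 φ.ex

/-- A dynamic program over the alphabet `α`: a finite relational auxiliary schema with a
distinguished `0`-ary symbol (the query bit), a first-order initialization formula over the input
schema for every auxiliary symbol, and a first-order update formula `φ_σ^R(x₁, …, x_k; y)` over the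
joint schema for every auxiliary symbol `R` and every change operation `set_σ`, `σ ∈ α ∪ {ε}`.
The variables `x₁, …, x_k` are indexed by `Fin k` and `y` by `Unit`. -/
structure DynProgram (α : Type u) where
  Aux : ℕ → Type
  finite_aux : Finite (Σ k, Aux k)
  query : Aux 0
  init : ∀ {k : ℕ}, Aux k → (inputSchema α).Formula (Fin k)
  update : ∀ {k : ℕ}, Option α → Aux k → (jointSchema α Aux).Formula (Fin k ⊕ Unit)

namespace DynProgram

variable {α : Type u} (P : DynProgram α)

/-- A state of the program on words with `n` positions: the current input word together with the
current auxiliary relations. -/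
structure State (n : ℕ) where
  word : Word α n
  aux : AuxInterp P.Aux n

/-- The initial state: all positions carry `ε`, and the auxiliary relations are defined from this
input by the initialization formulas. -/
def initial (n : ℕ) : P.State n where
  word := fun _ => none
  aux := fun _ R x =>
    @FirstOrder.Language.Formula.Realize (inputSchema α) (Fin n)
      (inputStructure fun _ => none) _ (P.init R) x

/-- The effect of the change `set_σ(i)`: the input word is changed at position `i`, and the update
formulas are evaluated over the new input word and the old auxiliary relations. -/
def step {n : ℕ} (s : P.State n) (c : Option α × Fin n) : P.State n where
  word := Function.update s.word c.2 c.1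
  aux := fun _ R x =>
    @FirstOrder.Language.Formula.Realize (jointSchema α P.Aux) (Fin n)
      (jointStructure (Function.update s.word c.2 c.1) s.aux) _ (P.update c.1 R)
      (Sum.elim x fun _ => c.2)

/-- The state reached from the initial one by a sequence of changes `set_σ(i)`. -/
def run (n : ℕ) (cs : List (Option α × Fin n)) : P.State n :=
  cs.foldl P.step (P.initial n)

/-- The program maintains membership in `L`: for every number of positions and after every sequence
of changes, the query bit is true if and only if the current input word is in `L`. -/
def Maintains (L : Language α) : Prop :=
  ∀ (n : ℕ) (cs : List (Option α × Fin n)),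
    (P.run n cs).aux 0 P.query Fin.elim0 ↔ (P.run n cs).word.toList ∈ L

/-- All auxiliary relations are at most unary. -/
def AtMostUnary : Prop := ∀ k : ℕ, 1 < k → IsEmpty (P.Aux k)

/-- All update formulas are `∃*∀*`-formulas. -/
def UpdatesSigma2 : Prop := ∀ (k : ℕ) (σ : Option α) (R : P.Aux k), IsSigma2 (P.update σ R)

end DynProgram

/-- The languages over `α` whose dynamic membership problem can be maintained by a dynamic program
with at most unary auxiliary relations, `∃*∀*` update formulas and first-order initialization. -/
def UDynSigma2 (α : Type u) : Set (Language α) :=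
  {L | ∃ P : DynProgram α, P.AtMostUnary ∧ P.UpdatesSigma2 ∧ P.Maintains L}

end DynWord

/-!
A regular language is recognized by a finite monoid `M`, and the product of a word over `M` has to
be maintained under changes of single letters. The program stores, at every position, the letter
of that position and the state in which a fixed finite automaton, the scanning automaton `Scan M`,
arrives there. When the letter at position `y` is changed, the states after `y` have to be
replaced by those of a second run of the automaton that starts at `y` in another state and reads
the same letters.

The automaton is designed such that on a common word any run is a function of any other run, and
this function changes only a bounded number of times. Its state keeps the product of the word read
so far, the `𝓛`-classes of the products of its suffixes, and, for every `𝓙`-class `J`, a reference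
point `f` in the `𝓛`-class of those suffix products that lie in `J`. By stability of finite
monoids (`LLe.lEq_of_jLe`) there is at most one such `𝓛`-class, as suffixes are comparable. The
reference point is multiplied by each letter, and it is reset only if this leads out of `J`. If
`m` is the product of the letters after `y` and `m` lies in `J`, then `m = g * f` for some `g`,
and this `g` stays the same as long as `m` stays in `J`, because no reset happens meanwhile
(`Scan.Valid.step_ref_of_stay`). So `m` is a piecewise constant function of the old state. The new
product and the new suffixes are determined by `m` and the old ones. The new reference point for a
class `J` is `g * m` for some `g`, or there is none, as long as `m` is neither in `J` nor below
it; here `g` changes only when a left multiple of `m` enters or leaves `J`. Afterwards the old and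
the new reference point for `J` lie in the same `𝓛`-class and are reset at the same times; up to
the first reset the new one is obtained from the old one by a fixed left multiplication, from then
on they are equal. The finitely many monotone events that separate these phases are `Event`, and
the conclusion is `IsRun.eq_of_no_event`.

The update formula guesses the positions `e` of the events and verifies, by a universal quantifier
over single positions `u`, that a family `δ` of maps between states, indexed by the set of events
that have happened, is compatible with the transitions (`Consistent`). This local condition forces
the guess to be correct (`Consistent.eq_scanTo`), and a correct guess exists
(`exists_consistent`). The choice of `δ` is a finite disjunction, which is moved behind the
universal quantifiers by giving every `δ` a universal variable of its own
(`Sigma2Definable.exists_forall`).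
-/

namespace DynWord

/-! ### Green's preorders on a finite monoid -/

section Green

variable {M : Type*} [Monoid M] {x y z : M}

/-- Green's left preorder: `x` is a left multiple of `y`. -/
def LLe (x y : M) : Prop := ∃ a, x = a * y

/-- Green's two-sided preorder: `x` has `y` as a factor. -/
def JLe (x y : M) : Prop := ∃ a b, x = a * y * b

/-- Green's equivalence `𝓛`. -/
def LEq (x y : M) : Prop := LLe x y ∧ LLe y x

/-- Green's equivalence `𝓙`. -/
def JEq (x y : M) : Prop := JLe x y ∧ JLe y x

theorem LLe.refl (x : M) : LLe x x := ⟨1, (one_mul x).symm⟩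

theorem LLe.trans (h : LLe x y) (h' : LLe y z) : LLe x z := by
  obtain ⟨a, rfl⟩ := h
  obtain ⟨b, rfl⟩ := h'
  exact ⟨a * b, (mul_assoc a b z).symm⟩

theorem LLe.mul_right (h : LLe x y) (a : M) : LLe (x * a) (y * a) := by
  obtain ⟨b, rfl⟩ := h
  exact ⟨b, mul_assoc b y a⟩

theorem LLe.le_one (x : M) : LLe x 1 := ⟨x, (mul_one x).symm⟩

theorem LLe.mul_left (s x : M) : LLe (s * x) x := ⟨s, rfl⟩

theorem LLe.jLe (h : LLe x y) : JLe x y := by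
  obtain ⟨a, rfl⟩ := h
  exact ⟨a, 1, (mul_one _).symm⟩

theorem JLe.refl (x : M) : JLe x x := (LLe.refl x).jLe

theorem JLe.trans (h : JLe x y) (h' : JLe y z) : JLe x z := by
  obtain ⟨a, b, rfl⟩ := h
  obtain ⟨c, d, rfl⟩ := h'
  exact ⟨a * c, d * b, by simp only [mul_assoc]⟩

theorem JLe.mul_right (x a : M) : JLe (x * a) x := ⟨1, a, by simp⟩

theorem LEq.refl (x : M) : LEq x x := ⟨LLe.refl x, LLe.refl x⟩

theorem LEq.symm (h : LEq x y) : LEq y x := ⟨h.2, h.1⟩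

theorem LEq.trans (h : LEq x y) (h' : LEq y z) : LEq x z :=
  ⟨h.1.trans h'.1, h'.2.trans h.2⟩

theorem LEq.mul_right (h : LEq x y) (a : M) : LEq (x * a) (y * a) :=
  ⟨h.1.mul_right a, h.2.mul_right a⟩

theorem LEq.jEq (h : LEq x y) : JEq x y := ⟨h.1.jLe, h.2.jLe⟩

theorem JEq.symm (h : JEq x y) : JEq y x := ⟨h.2, h.1⟩

theorem JEq.trans (h : JEq x y) (h' : JEq y z) : JEq x z :=
  ⟨h.1.trans h'.1, h'.2.trans h.2⟩

/-- Stability of finite monoids: a left multiple of `y` that is a two-sided divisor of `y` is a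
left divisor of `y`. -/
theorem LLe.lEq_of_jLe [Finite M] (h : LLe x y) (h' : JLe y x) : LEq x y := by
  refine ⟨h, ?_⟩
  obtain ⟨a, rfl⟩ := h
  obtain ⟨c, d, h'⟩ := h'
  have hpow : ∀ k : ℕ, y = (c * a) ^ k * y * d ^ k := by
    intro k
    induction k with
    | zero => simp
    | succ k ih =>
      calc y = (c * a) ^ k * y * d ^ k := ih
        _ = (c * a) ^ k * (c * (a * y) * d) * d ^ k := by rw [← h']
        _ = (c * a) ^ (k + 1) * y * d ^ (k + 1) := by
          rw [pow_succ, pow_succ']; simp only [mul_assoc]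
  obtain ⟨k, l, hkl, he⟩ : ∃ k l : ℕ, k < l ∧ (c * a) ^ k = (c * a) ^ l := by
    obtain ⟨k, l, hne, he⟩ := Finite.exists_ne_map_eq_of_infinite fun k : ℕ => (c * a) ^ k
    rcases hne.lt_or_gt with hlt | hlt
    · exact ⟨k, l, hlt, he⟩
    · exact ⟨l, k, hlt, he.symm⟩
  obtain ⟨r, rfl⟩ := Nat.exists_eq_add_of_lt hkl
  -- `(c * a) ^ (r + 1)` fixes `(c * a) ^ k`, hence also `y = (c * a) ^ k * y * d ^ k`.
  have hfix : y = (c * a) ^ (r + 1) * y := by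
    calc y = (c * a) ^ k * y * d ^ k := hpow k
      _ = (c * a) ^ (r + 1) * ((c * a) ^ k * y * d ^ k) := by
        conv_lhs => rw [he, show k + r + 1 = (r + 1) + k by omega, pow_add]
        simp only [mul_assoc]
      _ = (c * a) ^ (r + 1) * y := by rw [← hpow k]
  exact ⟨(c * a) ^ r * c, by rw [pow_succ] at hfix; simpa only [mul_assoc] using hfix⟩

end Green

/-! ### The scanning automaton -/

section Scan

variable {M : Type*} [Monoid M]

/-- The elements of `S` in the `𝓙`-class of `j`. -/
def slice (S : Set M) (j : M) : Set M := {x | x ∈ S ∧ JEq x j}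

open Classical in
/-- An arbitrary element of `S`, and the junk value `1` if `S` is empty. -/
noncomputable def pick (S : Set M) : M := if h : S.Nonempty then h.some else 1

theorem pick_mem {S : Set M} (h : S.Nonempty) : pick S ∈ S := by
  rw [pick, dif_pos h]; exact h.some_mem

theorem pick_of_not_nonempty {S : Set M} (h : ¬ S.Nonempty) : pick S = 1 := by
  rw [pick, dif_neg h]

/-- A state of the scanning automaton after reading a word `t` over `M`. -/
@[ext]
structure Scan (M : Type*) where
  /-- The product of the word. -/
  val : M
  /-- All elements that are `𝓛`-equivalent to the product of a suffix of the word. -/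
  suff : Set M
  /-- For every `𝓙`-class, given by a member `j`, a reference point in the `𝓛`-class of those
  suffix products that lie in it; `1` if there are none. -/
  ref : M → M

instance [Finite M] : Finite (Scan M) :=
  Finite.of_injective (fun q : Scan M => (q.val, q.suff, q.ref)) fun q r h => by
    simp only [Prod.mk.injEq] at h
    exact Scan.ext h.1 h.2.1 h.2.2

namespace Scan

/-- The state after the empty word. -/
noncomputable def start : Scan M where
  val := 1
  suff := {x | LEq x 1}
  ref j := pick (slice {x | LEq x 1} j)

open Classical in
/-- Reading one more letter. The reference points are multiplied by the letter as long as this does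
not lead out of the `𝓙`-class; otherwise they are reset to a point that depends only on the
`𝓛`-class. -/
noncomputable def step (q : Scan M) (a : M) : Scan M where
  val := q.val * a
  suff := {x | LEq x 1 ∨ ∃ s ∈ q.suff, LEq x (s * a)}
  ref j :=
    if q.ref j * a ∈ slice {x | LEq x 1 ∨ ∃ s ∈ q.suff, LEq x (s * a)} j then q.ref j * a
    else pick (slice {x | LEq x 1 ∨ ∃ s ∈ q.suff, LEq x (s * a)} j)

theorem mem_step_suff {q : Scan M} {a x : M} :
    x ∈ (q.step a).suff ↔ LEq x 1 ∨ ∃ s ∈ q.suff, LEq x (s * a) := Iff.rfl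

theorem step_ref_of_mem {q : Scan M} {a j : M} (h : q.ref j * a ∈ slice (q.step a).suff j) :
    (q.step a).ref j = q.ref j * a := if_pos h

theorem step_ref_of_notMem {q : Scan M} {a j : M} (h : q.ref j * a ∉ slice (q.step a).suff j) :
    (q.step a).ref j = pick (slice (q.step a).suff j) := if_neg h

/-- The properties of the states that are reached from `Scan.start`. -/
structure Valid (q : Scan M) : Prop where
  one_mem : 1 ∈ q.suff
  mem_of_lEq : ∀ {x y}, x ∈ q.suff → LEq y x → y ∈ q.suff
  total : ∀ {x y}, x ∈ q.suff → y ∈ q.suff → LLe x y ∨ LLe y x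
  ref_mem : ∀ {j}, (slice q.suff j).Nonempty → q.ref j ∈ slice q.suff j
  ref_eq_one : ∀ {j}, ¬ (slice q.suff j).Nonempty → q.ref j = 1

theorem valid_start : (start : Scan M).Valid where
  one_mem := LEq.refl 1
  mem_of_lEq hx h := h.trans hx
  total hx hy := Or.inl (hx.trans hy.symm).1
  ref_mem h := pick_mem h
  ref_eq_one h := pick_of_not_nonempty h

theorem Valid.step {q : Scan M} (h : q.Valid) (a : M) : (q.step a).Valid where
  one_mem := Or.inl (LEq.refl 1)
  mem_of_lEq := by
    rintro x y (hx | ⟨s, hs, hx⟩) hy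
    · exact Or.inl (hy.trans hx)
    · exact Or.inr ⟨s, hs, hy.trans hx⟩
  total := by
    rintro x y (hx | ⟨s, hs, hx⟩) (hy | ⟨r, hr, hy⟩)
    · exact Or.inl (hx.trans hy.symm).1
    · exact Or.inr ((LLe.le_one y).trans hx.2)
    · exact Or.inl ((LLe.le_one x).trans hy.2)
    · rcases h.total hs hr with hsr | hsr
      · exact Or.inl (hx.1.trans ((hsr.mul_right a).trans hy.2))
      · exact Or.inr (hy.1.trans ((hsr.mul_right a).trans hx.2))
  ref_mem {j} hne := by
    by_cases hm : q.ref j * a ∈ slice (q.step a).suff j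
    · rw [step_ref_of_mem hm]; exact hm
    · rw [step_ref_of_notMem hm]; exact pick_mem hne
  ref_eq_one {j} hne := by
    rw [step_ref_of_notMem fun hm => hne ⟨_, hm⟩]
    exact pick_of_not_nonempty hne

theorem start_step_one : (start : Scan M).step 1 = start := by
  have hS : ((start : Scan M).step 1).suff = (start : Scan M).suff := by
    ext x
    rw [mem_step_suff]
    constructor
    · rintro (hx | ⟨s, hs, hx⟩)
      · exact hx
      · rw [mul_one] at hx
        exact hx.trans hs
    · exact Or.inl
  refine Scan.ext (mul_one 1) hS (funext fun j => ?_)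
  by_cases hm : (start : Scan M).ref j * 1 ∈ slice ((start : Scan M).step 1).suff j
  · rw [step_ref_of_mem hm, mul_one]
  · rw [step_ref_of_notMem hm, hS]
    rfl

/-- The suffix products in one `𝓙`-class form at most one `𝓛`-class, as suffixes are comparable. -/
theorem Valid.lEq_of_mem_slice [Finite M] {q : Scan M} (h : q.Valid) {j x y : M}
    (hx : x ∈ slice q.suff j) (hy : y ∈ slice q.suff j) : LEq x y := by
  have hxy : JEq x y := hx.2.trans hy.2.symm
  rcases h.total hx.1 hy.1 with hle | hle
  · exact hle.lEq_of_jLe hxy.2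
  · exact (hle.lEq_of_jLe hxy.1).symm

theorem Valid.mem_slice_of_lEq {q : Scan M} (h : q.Valid) {j x y : M}
    (hx : x ∈ slice q.suff j) (hy : LEq y x) : y ∈ slice q.suff j :=
  ⟨h.mem_of_lEq hx.1 hy, hy.jEq.trans hx.2⟩

/-- A reference point is not reset as long as some suffix product stays in its `𝓙`-class. -/
theorem Valid.step_ref_of_stay [Finite M] {q : Scan M} (h : q.Valid) {a j x : M}
    (hx : x ∈ slice q.suff j) (hxa : JEq (x * a) j) : (q.step a).ref j = q.ref j * a := by
  have href := h.lEq_of_mem_slice (h.ref_mem ⟨x, hx⟩) hx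
  refine step_ref_of_mem ⟨?_, (href.mul_right a).jEq.trans hxa⟩
  exact Or.inr ⟨x, hx.1, href.mul_right a⟩

end Scan

/-! ### Two runs of the scanning automaton on the same word -/

/-- The product of the first `i` letters of the sequence `a`. -/
def prodTo (a : ℕ → M) : ℕ → M
  | 0 => 1
  | i + 1 => prodTo a i * a i

/-- The elements that are `𝓛`-equivalent to the product of a suffix of the first `i` letters of
the sequence `a`. -/
def sufTo (a : ℕ → M) : ℕ → Set M
  | 0 => {x | LEq x 1}
  | i + 1 => {x | LEq x 1 ∨ ∃ s ∈ sufTo a i, LEq x (s * a i)}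

theorem mem_sufTo_of_lEq {a : ℕ → M} {i : ℕ} {x y : M} (hx : x ∈ sufTo a i) (h : LEq y x) :
    y ∈ sufTo a i := by
  cases i with
  | zero => exact h.trans hx
  | succ i =>
    rcases hx with hx | ⟨s, hs, hx⟩
    · exact Or.inl (h.trans hx)
    · exact Or.inr ⟨s, hs, h.trans hx⟩

theorem prodTo_mem_sufTo (a : ℕ → M) (i : ℕ) : prodTo a i ∈ sufTo a i := by
  induction i with
  | zero => exact LEq.refl 1
  | succ i ih => exact Or.inr ⟨_, ih, LEq.refl _⟩

theorem prodTo_lLe {a : ℕ → M} {i : ℕ} {x : M} (hx : x ∈ sufTo a i) : LLe (prodTo a i) x := by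
  induction i generalizing x with
  | zero => exact hx.2
  | succ i ih =>
    rcases hx with hx | ⟨s, hs, hx⟩
    · exact (LLe.le_one _).trans hx.2
    · exact ((ih hs).mul_right (a i)).trans hx.2

theorem jLe_mul_prodTo (a : ℕ → M) (s : M) {i k : ℕ} (h : i ≤ k) :
    JLe (s * prodTo a k) (s * prodTo a i) := by
  induction k, h using Nat.le_induction with
  | base => exact JLe.refl _
  | succ k _ ih =>
    rw [prodTo, ← mul_assoc]
    exact (JLe.mul_right _ _).trans ih

/-- `r` is a run of the scanning automaton on the sequence `a` that starts in a valid state. -/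
structure IsRun (a : ℕ → M) (r : ℕ → Scan M) : Prop where
  valid_zero : (r 0).Valid
  succ : ∀ i, r (i + 1) = (r i).step (a i)

namespace IsRun

variable {a : ℕ → M} {r r' : ℕ → Scan M} {i k : ℕ} {j x : M}

theorem valid (h : IsRun a r) (i : ℕ) : (r i).Valid := by
  induction i with
  | zero => exact h.valid_zero
  | succ i ih => rw [h.succ]; exact ih.step _

theorem val_eq (h : IsRun a r) (i : ℕ) : (r i).val = (r 0).val * prodTo a i := by
  induction i with
  | zero => simp [prodTo]
  | succ i ih => rw [h.succ, prodTo, ← mul_assoc, ← ih]; rfl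

/-- A suffix either starts after time `0` or consists of a suffix at time `0` and of all later
letters. -/
theorem mem_suff (h : IsRun a r) (i : ℕ) {x : M} : x ∈ (r i).suff ↔
    x ∈ sufTo a i ∨ ∃ s ∈ (r 0).suff, LEq x (s * prodTo a i) := by
  induction i generalizing x with
  | zero =>
    simp only [prodTo, mul_one]
    constructor
    · exact fun hx => Or.inr ⟨x, hx, LEq.refl x⟩
    · rintro (hx | ⟨s, hs, hx⟩)
      · exact h.valid_zero.mem_of_lEq h.valid_zero.one_mem hx
      · exact h.valid_zero.mem_of_lEq hs hx
  | succ i ih =>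
    rw [h.succ, Scan.mem_step_suff]
    constructor
    · rintro (hx | ⟨s, hs, hx⟩)
      · exact Or.inl (Or.inl hx)
      · rcases ih.1 hs with hs | ⟨t, ht, hs⟩
        · exact Or.inl (Or.inr ⟨s, hs, hx⟩)
        · refine Or.inr ⟨t, ht, hx.trans ?_⟩
          rw [prodTo, ← mul_assoc]
          exact hs.mul_right _
    · rintro ((hx | ⟨s, hs, hx⟩) | ⟨t, ht, hx⟩)
      · exact Or.inl hx
      · exact Or.inr ⟨s, ih.2 (Or.inl hs), hx⟩
      · rw [prodTo, ← mul_assoc] at hx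
        exact Or.inr ⟨_, ih.2 (Or.inr ⟨t, ht, LEq.refl _⟩), hx⟩

theorem mem_sufTo_iff [Finite M] (h : IsRun a r) :
    x ∈ sufTo a i ↔ x ∈ (r i).suff ∧ LLe (prodTo a i) x := by
  refine ⟨fun hx => ⟨(h.mem_suff i).2 (Or.inl hx), prodTo_lLe hx⟩, fun ⟨hx, hle⟩ => ?_⟩
  rcases (h.mem_suff i).1 hx with hx | ⟨s, -, hx⟩
  · exact hx
  · exact mem_sufTo_of_lEq (prodTo_mem_sufTo a i) ⟨hx.1.trans (LLe.mul_left _ _), hle⟩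

theorem prodTo_mem_suff (h : IsRun a r) (i : ℕ) : prodTo a i ∈ (r i).suff :=
  (h.mem_suff i).2 (Or.inl (prodTo_mem_sufTo a i))

/-- In the `𝓙`-classes above the product of the word read since time `0`, the suffixes do not depend
on what was read before. -/
theorem slice_subset [Finite M] (h : IsRun a r) (h' : IsRun a r') (hj : JLe (prodTo a i) j) :
    slice (r i).suff j ⊆ slice (r' i).suff j := by
  rintro x ⟨hx, hxj⟩
  refine ⟨(h'.mem_suff i).2 (Or.inl ?_), hxj⟩
  rcases (h.mem_suff i).1 hx with hx | ⟨s, -, hx⟩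
  · exact hx
  · have hle : LLe x (prodTo a i) := hx.1.trans (LLe.mul_left _ _)
    exact mem_sufTo_of_lEq (prodTo_mem_sufTo a i) (hle.lEq_of_jLe (hj.trans hxj.2))

theorem slice_eq [Finite M] (h : IsRun a r) (h' : IsRun a r') (hj : JLe (prodTo a i) j) :
    slice (r i).suff j = slice (r' i).suff j :=
  (h.slice_subset h' hj).antisymm (h'.slice_subset h hj)

/-- Once two runs agree on a reference point whose `𝓙`-class is above the product of the word read
since time `0`, they agree on it forever. -/
theorem ref_succ_eq [Finite M] (h : IsRun a r) (h' : IsRun a r') (hj : JLe (prodTo a i) j)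
    (he : (r i).ref j = (r' i).ref j) : (r (i + 1)).ref j = (r' (i + 1)).ref j := by
  have hj' : JLe (prodTo a (i + 1)) j := (JLe.mul_right _ _).trans hj
  have hs := h.slice_eq h' hj'
  rw [h.succ, h'.succ] at hs ⊢
  by_cases hm : (r i).ref j * a i ∈ slice ((r i).step (a i)).suff j
  · rw [Scan.step_ref_of_mem hm, Scan.step_ref_of_mem (by rwa [← hs, ← he]), he]
  · rw [Scan.step_ref_of_notMem hm, Scan.step_ref_of_notMem (by rwa [← hs, ← he]), hs]

/-- If two runs do not agree on a reference point whose `𝓙`-class is above the product of the word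
read since time `0`, then it was not reset in either of them. -/
theorem ref_succ_of_ne [Finite M] (h : IsRun a r) (h' : IsRun a r') (hj : JLe (prodTo a i) j)
    (hne : (r (i + 1)).ref j ≠ (r' (i + 1)).ref j) :
    (r (i + 1)).ref j = (r i).ref j * a i ∧ (r' (i + 1)).ref j = (r' i).ref j * a i := by
  have hj' : JLe (prodTo a (i + 1)) j := (JLe.mul_right _ _).trans hj
  have hs := h.slice_eq h' hj
  have hs' := h.slice_eq h' hj'
  have hv := (h.valid i).step (a i)
  have hL : LEq ((r i).ref j) ((r' i).ref j) := by
    by_cases hn : (slice (r i).suff j).Nonempty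
    · refine (h.valid i).lEq_of_mem_slice ((h.valid i).ref_mem hn) ?_
      rw [hs] at hn ⊢
      exact (h'.valid i).ref_mem hn
    · rw [(h.valid i).ref_eq_one hn, (h'.valid i).ref_eq_one (by rwa [← hs])]
      exact LEq.refl 1
  rw [h.succ, h'.succ] at hs' hne ⊢
  by_cases hm : (r i).ref j * a i ∈ slice ((r i).step (a i)).suff j
  · refine ⟨Scan.step_ref_of_mem hm, Scan.step_ref_of_mem ?_⟩
    rw [← hs']
    exact hv.mem_slice_of_lEq hm (hL.mul_right _).symm
  · refine absurd ?_ hne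
    rw [Scan.step_ref_of_notMem hm, Scan.step_ref_of_notMem fun hm' => hm ?_, hs']
    rw [← hs'] at hm'
    exact hv.mem_slice_of_lEq hm' (hL.mul_right _)

end IsRun

/-- Two sequences that evolve by multiplication with the same letters keep a left multiplication
that relates them. -/
theorem eq_mul_of_mul_steps {a u v : ℕ → M} {g : M} {i k : ℕ} (hik : i ≤ k)
    (hu : ∀ l, i ≤ l → l < k → u (l + 1) = u l * a l)
    (hv : ∀ l, i ≤ l → l < k → v (l + 1) = v l * a l) (h : u i = g * v i) : u k = g * v k := by
  induction k, hik using Nat.le_induction with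
  | base => exact h
  | succ k hik ih =>
    rw [hu k hik k.lt_succ_self, hv k hik k.lt_succ_self, ← mul_assoc,
      ← ih (fun l h₁ h₂ => hu l h₁ (h₂.trans k.lt_succ_self))
        fun l h₁ h₂ => hv l h₁ (h₂.trans k.lt_succ_self)]

/-- The events that can change the way in which one run of the scanning automaton is determined by
another one on the same word: a left multiple of the word read so far falls below some element of
`M`, or the runs come to agree on a reference point. -/
def Event (a : ℕ → M) (r r' : ℕ → Scan M) : (M × M) ⊕ M → ℕ → Prop
  | .inl (s, z), i => JLe (s * prodTo a i) z
  | .inr j, i => JLe (prodTo a i) j ∧ (r i).ref j = (r' i).ref j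

variable [Finite M] {a : ℕ → M} {r r' : ℕ → Scan M}

theorem event_mono (h : IsRun a r) (h' : IsRun a r') (t : (M × M) ⊕ M) :
    Monotone (Event a r r' t) := by
  intro i k hik
  rcases t with ⟨s, z⟩ | j
  · exact fun he => (jLe_mul_prodTo a s hik).trans he
  · intro he
    induction k, hik using Nat.le_induction with
    | base => exact he
    | succ k _ ih => exact ⟨(JLe.mul_right _ _).trans ih.1, h.ref_succ_eq h' ih.1 ih.2⟩

/-- As long as no event happens, a run is determined by any other run on the same word. -/
theorem IsRun.eq_of_no_event (h : IsRun a r) (h' : IsRun a r') {i k : ℕ} (hik : i ≤ k)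
    (hE : ∀ t, Event a r r' t k → Event a r r' t i) (hr : r i = r k) : r' i = r' k := by
  have hJ : ∀ s l, i ≤ l → l ≤ k → JEq (s * prodTo a l) (s * prodTo a i) := fun s l hil hlk =>
    ⟨jLe_mul_prodTo a s hil, hE (.inl (s, s * prodTo a l)) (jLe_mul_prodTo a s hlk)⟩
  have hJ₁ : ∀ l, i ≤ l → l ≤ k → JEq (prodTo a l) (prodTo a i) := fun l hil hlk => by
    simpa using hJ 1 l hil hlk
  -- The reference point for the `𝓙`-class of the product is not reset.
  have hprod : prodTo a i = prodTo a k := by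
    have hmem : ∀ l, i ≤ l → l ≤ k → prodTo a l ∈ slice (r l).suff (prodTo a i) :=
      fun l hil hlk => ⟨h.prodTo_mem_suff l, hJ₁ l hil hlk⟩
    have hi := hmem i le_rfl hik
    obtain ⟨g, hg⟩ := ((h.valid i).lEq_of_mem_slice hi ((h.valid i).ref_mem ⟨_, hi⟩)).1
    have := eq_mul_of_mul_steps (u := prodTo a) (v := fun l => (r l).ref (prodTo a i)) hik
      (fun l _ _ => rfl) (fun l hil hlk => by
        rw [h.succ]
        exact (h.valid l).step_ref_of_stay (hmem l hil hlk.le) (hJ₁ (l + 1) (by omega) hlk)) hg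
    exact hg.trans (by rw [this, hr])
  refine Scan.ext ?_ ?_ (funext fun j => ?_)
  · rw [h'.val_eq i, h'.val_eq k, hprod]
  · ext x
    rw [h'.mem_suff, h'.mem_suff, h.mem_sufTo_iff, h.mem_sufTo_iff, hprod, hr]
  · by_cases hj : JLe (prodTo a k) j
    · have hji : ∀ l, i ≤ l → JLe (prodTo a l) j := fun l hil =>
        (hprod ▸ (by simpa using jLe_mul_prodTo a 1 hil) : JLe _ (prodTo a k)).trans hj
      by_cases he : (r k).ref j = (r' k).ref j
      · rw [← he, ← (hE (.inr j) ⟨hj, he⟩).2, hr]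
      · have hne : ∀ l, i ≤ l → l ≤ k → (r l).ref j ≠ (r' l).ref j := fun l hil hlk hel =>
          he (event_mono h h' (.inr j) hlk ⟨hji l hil, hel⟩).2
        have hstep := fun l hil (hlk : l < k) =>
          h.ref_succ_of_ne h' (hji l hil) (hne (l + 1) (by omega) hlk)
        have hs := h.slice_eq h' (hji i le_rfl)
        have hn : (slice (r i).suff j).Nonempty := by
          by_contra hn
          refine hne i le_rfl hik ?_
          rw [(h.valid i).ref_eq_one hn, (h'.valid i).ref_eq_one (by rwa [← hs])]
        obtain ⟨g, hg⟩ := ((h.valid i).lEq_of_mem_slice (hs ▸ (h'.valid i).ref_mem (hs ▸ hn))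
          ((h.valid i).ref_mem hn)).1
        have := eq_mul_of_mul_steps (u := fun l => (r' l).ref j) (v := fun l => (r l).ref j) hik
          (fun l hil hlk => (hstep l hil hlk).2) (fun l hil hlk => (hstep l hil hlk).1) hg
        rw [this, hg, hr]
    · -- All suffixes in the `𝓙`-class of `j` start before time `0`.
      have hcross : ∀ l, i ≤ l → l ≤ k → ∀ x ∈ slice (r' l).suff j,
          ∃ s ∈ (r' 0).suff, LEq x (s * prodTo a l) := by
        rintro l hil hlk x ⟨hx, hxj⟩
        refine ((h'.mem_suff l).1 hx).resolve_left fun hx => hj ?_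
        refine JLe.trans ?_ ((prodTo_lLe hx).jLe.trans hxj.1)
        rw [← hprod]
        exact (hJ₁ l hil hlk).2
      by_cases hn : ∃ s ∈ (r' 0).suff, JEq (s * prodTo a i) j
      · obtain ⟨s, hs, hsj⟩ := hn
        have hmem : ∀ l, i ≤ l → l ≤ k → s * prodTo a l ∈ slice (r' l).suff j := fun l hil hlk =>
          ⟨(h'.mem_suff l).2 (Or.inr ⟨s, hs, LEq.refl _⟩), (hJ s l hil hlk).trans hsj⟩
        have hi := hmem i le_rfl hik
        obtain ⟨g, hg⟩ := ((h'.valid i).lEq_of_mem_slice ((h'.valid i).ref_mem ⟨_, hi⟩) hi).1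
        rw [← mul_assoc] at hg
        have := eq_mul_of_mul_steps (u := fun l => (r' l).ref j) (v := prodTo a) hik
          (fun l hil hlk => by
            rw [h'.succ]
            refine (h'.valid l).step_ref_of_stay (hmem l hil hlk.le) ?_
            rw [mul_assoc]
            exact (hmem (l + 1) (by omega) hlk).2) (fun l _ _ => rfl) hg
        rw [this, hg, hprod]
      · have hempty : ∀ l, i ≤ l → l ≤ k → ¬ (slice (r' l).suff j).Nonempty := by
          rintro l hil hlk ⟨x, hx⟩
          obtain ⟨s, hs, hxs⟩ := hcross l hil hlk x hx
          exact hn ⟨s, hs, (hJ s l hil hlk).symm.trans (hxs.symm.jEq.trans hx.2)⟩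
        rw [(h'.valid i).ref_eq_one (hempty i le_rfl hik),
          (h'.valid k).ref_eq_one (hempty k hik le_rfl)]

end Scan

/-! ### Quantifier-free and `∃*∀*`-definable properties of the auxiliary relations -/

section Definability

open FirstOrder FirstOrder.Language

variable {α : Type u} {Aux : ℕ → Type} {V W : Type}

/-- Properties of tuples of positions, indexed by `V`, that are defined from the auxiliary relations
by a quantifier-free formula, for all words over `α` at once. -/
def QFDefinable (α : Type u) (Ψ : ∀ n : ℕ, AuxInterp Aux n → (V → Fin n) → Prop) : Prop :=
  ∃ φ : (jointSchema α Aux).Formula V, BoundedFormula.IsQF φ ∧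
    ∀ (n : ℕ) (w : Word α n) (A : AuxInterp Aux n) (v : V → Fin n),
      @Formula.Realize (jointSchema α Aux) (Fin n) (jointStructure w A) _ φ v ↔ Ψ n A v

/-- Properties of tuples of positions, indexed by `V`, that are defined from the auxiliary relations
by an `∃*∀*`-formula, for all words over `α` at once. -/
def Sigma2Definable (α : Type u) (Ψ : ∀ n : ℕ, AuxInterp Aux n → (V → Fin n) → Prop) : Prop :=
  ∃ φ : (jointSchema α Aux).Formula V, IsSigma2 φ ∧
    ∀ (n : ℕ) (w : Word α n) (A : AuxInterp Aux n) (v : V → Fin n),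
      @Formula.Realize (jointSchema α Aux) (Fin n) (jointStructure w A) _ φ v ↔ Ψ n A v

namespace QFDefinable

variable {Ψ Ψ' : ∀ n : ℕ, AuxInterp Aux n → (V → Fin n) → Prop}

theorem const (p : Prop) : QFDefinable α fun n (_ : AuxInterp Aux n) (_ : V → Fin n) => p := by
  by_cases hp : p
  · exact ⟨⊤, BoundedFormula.IsQF.top, fun n w A v => by
      let _ := jointStructure w A
      simp [hp]⟩
  · exact ⟨⊥, BoundedFormula.isQF_bot, fun n w A v => by
      let _ := jointStructure w A
      simp [hp]⟩

theorem not (h : QFDefinable α Ψ) : QFDefinable α fun n A v => ¬ Ψ n A v := by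
  obtain ⟨φ, hφ, h⟩ := h
  refine ⟨φ.not, hφ.not, fun n w A v => ?_⟩
  let _ := jointStructure w A
  exact Formula.realize_not.trans (not_congr (h n w A v))

theorem and (h : QFDefinable α Ψ) (h' : QFDefinable α Ψ') :
    QFDefinable α fun n A v => Ψ n A v ∧ Ψ' n A v := by
  obtain ⟨φ, hφ, h⟩ := h
  obtain ⟨φ', hφ', h'⟩ := h'
  refine ⟨φ ⊓ φ', hφ.inf hφ', fun n w A v => ?_⟩
  let _ := jointStructure w A
  exact Formula.realize_inf.trans (and_congr (h n w A v) (h' n w A v))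

theorem congr (h : QFDefinable α Ψ) (hΨ : ∀ n A v, Ψ' n A v ↔ Ψ n A v) : QFDefinable α Ψ' := by
  obtain ⟨φ, hφ, h⟩ := h
  exact ⟨φ, hφ, fun n w A v => (h n w A v).trans (hΨ n A v).symm⟩

theorem or (h : QFDefinable α Ψ) (h' : QFDefinable α Ψ') :
    QFDefinable α fun n A v => Ψ n A v ∨ Ψ' n A v :=
  (h.not.and h'.not).not.congr fun n A v => by tauto

theorem imp (h : QFDefinable α Ψ) (h' : QFDefinable α Ψ') :
    QFDefinable α fun n A v => Ψ n A v → Ψ' n A v :=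
  (h.and h'.not).not.congr fun n A v => by tauto

theorem iff (h : QFDefinable α Ψ) (h' : QFDefinable α Ψ') :
    QFDefinable α fun n A v => Ψ n A v ↔ Ψ' n A v :=
  ((h.imp h').and (h'.imp h)).congr fun n A v => by tauto

theorem forall_finite {ι : Type*} [Finite ι]
    {Ψ : ι → ∀ n : ℕ, AuxInterp Aux n → (V → Fin n) → Prop} (h : ∀ i, QFDefinable α (Ψ i)) :
    QFDefinable α fun n A v => ∀ i, Ψ i n A v := by
  have hs : ∀ s : Set ι, s.Finite → QFDefinable α fun n A v => ∀ i ∈ s, Ψ i n A v := by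
    intro s hs
    induction s, hs using Set.Finite.induction_on with
    | empty => exact (const True).congr fun n A v => by simp
    | @insert i s _ _ ih => exact ((h i).and ih).congr fun n A v => by simp
  exact (hs Set.univ Set.finite_univ).congr fun n A v => by simp

theorem exists_finite {ι : Type*} [Finite ι]
    {Ψ : ι → ∀ n : ℕ, AuxInterp Aux n → (V → Fin n) → Prop} (h : ∀ i, QFDefinable α (Ψ i)) :
    QFDefinable α fun n A v => ∃ i, Ψ i n A v :=
  (forall_finite fun i => (h i).not).not.congr fun n A v => by simp

/-- A finite-valued function of the tuple whose fibres are quantifier-free definable may be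
substituted into a finite family of quantifier-free definable properties. -/
theorem subst {ι : Type*} [Finite ι] {f : ∀ n : ℕ, (V → Fin n) → ι}
    {Ψ : ι → ∀ n : ℕ, AuxInterp Aux n → (V → Fin n) → Prop}
    (hf : ∀ i, QFDefinable α fun n (_ : AuxInterp Aux n) v => f n v = i)
    (h : ∀ i, QFDefinable α (Ψ i)) : QFDefinable α fun n A v => Ψ (f n v) n A v :=
  (exists_finite fun i => (hf i).and (h i)).congr fun n A v => by simp

theorem le (a b : V) : QFDefinable α fun n (_ : AuxInterp Aux n) (v : V → Fin n) => v a ≤ v b := by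
  refine ⟨Relations.formula₂ (L := jointSchema α Aux) (JointRel.input InputRel.le)
    (Term.var a) (Term.var b), (BoundedFormula.IsAtomic.rel _ _).isQF, fun n w A v => ?_⟩
  let _ := jointStructure w A
  exact Formula.realize_rel₂

theorem lt (a b : V) : QFDefinable α fun n (_ : AuxInterp Aux n) (v : V → Fin n) => v a < v b :=
  (le b a).not.congr fun _ _ _ => not_le.symm

theorem eq (a b : V) : QFDefinable α fun n (_ : AuxInterp Aux n) (v : V → Fin n) => v a = v b :=
  ((le a b).and (le b a)).congr fun _ _ _ => le_antisymm_iff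

theorem rel (R : Aux 1) (a : V) :
    QFDefinable α fun n (A : AuxInterp Aux n) (v : V → Fin n) => A 1 R fun _ => v a := by
  refine ⟨Relations.formula (L := jointSchema α Aux) (JointRel.aux R) fun _ => Term.var a,
    (BoundedFormula.IsAtomic.rel _ _).isQF, fun n w A v => ?_⟩
  let _ := jointStructure w A
  exact Formula.realize_rel

theorem rename (h : QFDefinable α Ψ) (ρ : V → W) :
    QFDefinable α fun n A (v : W → Fin n) => Ψ n A (v ∘ ρ) := by
  obtain ⟨φ, hφ, h⟩ := h
  refine ⟨φ.relabel ρ, hφ.relabel _, fun n w A v => ?_⟩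
  let _ := jointStructure w A
  exact Formula.realize_relabel.trans (h n w A (v ∘ ρ))

end QFDefinable

theorem exists_isUniversal_alls {S : FirstOrder.Language.{0, u}} {β : Type} {m : ℕ} (l : ℕ)
    (φ : S.BoundedFormula β (m + l)) (hφ : φ.IsUniversal) :
    ∃ ψ : S.BoundedFormula β m, ψ.IsUniversal ∧
      ∀ (N : Type) [S.Structure N] (v : β → N) (xs : Fin m → N),
        ψ.Realize v xs ↔ ∀ ys : Fin l → N, φ.Realize v (Fin.append xs ys) := by
  induction l with
  | zero =>
    refine ⟨φ, hφ, fun N _ v xs => ⟨fun h ys => ?_, fun h => ?_⟩⟩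
    · simpa [Fin.append_right_nil _ _ rfl] using h
    · simpa [Fin.append_right_nil _ _ rfl] using h Fin.elim0
  | succ l ih =>
    obtain ⟨ψ, hψ, h⟩ := ih (BoundedFormula.all (n := m + l) φ) (.all hφ)
    refine ⟨ψ, hψ, fun N _ v xs => (h N v xs).trans ?_⟩
    simp only [BoundedFormula.realize_all, ← Fin.append_snoc]
    exact ⟨fun h ys => by simpa using h (Fin.init ys) (ys (Fin.last l)),
      fun h ys y => h (Fin.snoc ys y)⟩

theorem exists_isSigma2_exs {S : FirstOrder.Language.{0, u}} {β : Type} {m : ℕ} (k : ℕ)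
    (φ : S.BoundedFormula β (m + k)) (hφ : IsSigma2 φ) :
    ∃ ψ : S.BoundedFormula β m, IsSigma2 ψ ∧
      ∀ (N : Type) [S.Structure N] (v : β → N) (xs : Fin m → N),
        ψ.Realize v xs ↔ ∃ ys : Fin k → N, φ.Realize v (Fin.append xs ys) := by
  induction k with
  | zero =>
    refine ⟨φ, hφ, fun N _ v xs => ⟨fun h => ⟨Fin.elim0, ?_⟩, fun ⟨ys, h⟩ => ?_⟩⟩
    · simpa [Fin.append_right_nil _ _ rfl] using h
    · simpa [Fin.append_right_nil _ _ rfl] using h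
  | succ k ih =>
    obtain ⟨ψ, hψ, h⟩ := ih (BoundedFormula.ex (n := m + k) φ) (.ex hφ)
    refine ⟨ψ, hψ, fun N _ v xs => (h N v xs).trans ?_⟩
    simp only [BoundedFormula.realize_ex, ← Fin.append_snoc]
    exact ⟨fun ⟨ys, y, h⟩ => ⟨Fin.snoc ys y, h⟩,
      fun ⟨ys, h⟩ => ⟨Fin.init ys, ys (Fin.last k), by simpa using h⟩⟩

/-- A finite disjunction between the existential and the universal quantifiers can be moved inwards
if every disjunct is given a universal variable of its own. -/
theorem Sigma2Definable.exists_forall {β κ ι : Type} [Finite κ] [Finite ι]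
    {Ψ : ι → ∀ n : ℕ, AuxInterp Aux n → (β ⊕ κ ⊕ Unit → Fin n) → Prop}
    (h : ∀ i, QFDefinable α (Ψ i)) :
    Sigma2Definable α fun n A (v : β → Fin n) => ∃ e : κ → Fin n, ∃ i, ∀ u : Fin n,
      Ψ i n A (Sum.elim v (Sum.elim e fun _ => u)) := by
  have eκ := Finite.equivFin κ
  have eι := Finite.equivFin ι
  let ρ (i : ι) : β ⊕ κ ⊕ Unit → β ⊕ Fin (0 + Nat.card κ + Nat.card ι) :=
    Sum.map id (Sum.elim (fun k => Fin.castAdd _ (Fin.natAdd 0 (eκ k)))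
      fun _ => Fin.natAdd _ (eι i))
  obtain ⟨φ, hφ, hφ'⟩ := QFDefinable.exists_finite fun i => (h i).rename (ρ i)
  let θ : (jointSchema α Aux).BoundedFormula β (0 + Nat.card κ + Nat.card ι) :=
    BoundedFormula.relabel (k := 0) id φ
  obtain ⟨ψ, hψ, hψ'⟩ := exists_isUniversal_alls (m := 0 + Nat.card κ) (Nat.card ι) θ
    (.of_isQF (hφ.relabel _))
  obtain ⟨χ, hχ, hχ'⟩ := exists_isSigma2_exs (m := 0) (Nat.card κ) ψ (.of_isUniversal hψ)
  refine ⟨χ, hχ, fun n w A v => ?_⟩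
  let _ := jointStructure w A
  have key : ∀ (e : Fin (Nat.card κ) → Fin n) (u : Fin (Nat.card ι) → Fin n),
      θ.Realize v (Fin.append (Fin.append (default : Fin 0 → Fin n) e) u) ↔
      ∃ i, Ψ i n A (Sum.elim v (Sum.elim (e ∘ eκ) fun _ => u (eι i))) := by
    intro e u
    refine (BoundedFormula.realize_relabel (n := 0)).trans ?_
    refine Iff.trans ?_ ((hφ' n w A (Sum.elim v (Fin.append (Fin.append default e) u))).trans ?_)
    · rw [Formula.Realize]
      exact iff_of_eq (congrArg₂ _ rfl (Subsingleton.elim _ _))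
    · refine exists_congr fun i => iff_of_eq (congrArg _ (funext ?_))
      rintro (b | k | -)
      · rfl
      · simp only [ρ, Function.comp_apply, Sum.map_inr, Sum.elim_inl, Sum.elim_inr]
        rw [Fin.append_left, Fin.append_right]
      · simp only [ρ, Function.comp_apply, Sum.map_inr, Sum.elim_inr]
        rw [Fin.append_right]
  rw [Formula.Realize, hχ']
  simp only [hψ', key]
  constructor
  · rintro ⟨e, he⟩
    refine ⟨e ∘ eκ, ?_⟩
    by_contra! hc
    choose u hu using hc
    obtain ⟨i, hi⟩ := he (u ∘ eι.symm)
    exact hu i (by simpa using hi)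
  · rintro ⟨e, i, hi⟩
    exact ⟨e ∘ eκ.symm, fun u => ⟨i, by simpa [Function.comp_assoc] using hi (u (eι i))⟩⟩

end Definability

/-! ### Changing one letter of a word -/

section Change

variable {M : Type*} [Monoid M]

/-- The state of the scanning automaton before reading letter number `i` of the sequence `b`. -/
noncomputable def scanTo (b : ℕ → M) : ℕ → Scan M
  | 0 => Scan.start
  | i + 1 => (scanTo b i).step (b i)

theorem valid_scanTo (b : ℕ → M) (i : ℕ) : (scanTo b i).Valid := by
  induction i with
  | zero => exact Scan.valid_start
  | succ i ih => exact ih.step _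

theorem val_scanTo (b : ℕ → M) (i : ℕ) : (scanTo b i).val = prodTo b i := by
  induction i with
  | zero => rfl
  | succ i ih => rw [prodTo, ← ih]; rfl

theorem scanTo_one (i : ℕ) : scanTo (fun _ => (1 : M)) i = Scan.start := by
  induction i with
  | zero => rfl
  | succ i ih => rw [scanTo, ih, Scan.start_step_one]

theorem scanTo_congr {b b' : ℕ → M} {i : ℕ} (h : ∀ k < i, b k = b' k) :
    scanTo b i = scanTo b' i := by
  induction i with
  | zero => rfl
  | succ i ih => rw [scanTo, scanTo, ih fun k hk => h k (by omega), h i (by omega)]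

theorem scanTo_update_of_le (b : ℕ → M) {y i : ℕ} (h : i ≤ y) (c : M) :
    scanTo (Function.update b y c) i = scanTo b i :=
  scanTo_congr fun _ hk => Function.update_of_ne (by omega) _ _

theorem isRun_scanTo (b : ℕ → M) (y : ℕ) :
    IsRun (fun i => b (y + i)) fun i => scanTo b (y + i) :=
  ⟨valid_scanTo b _, fun _ => rfl⟩

variable {n : ℕ} {κ : Type*}

/-- The local conditions at the position `u` that make `δ` describe the run of the scanning
automaton after the letter at position `y` has been changed to `c`, up to the position `x`: the
state of the new run before a position is the image of the state of the old run before that position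
under `δ T`, where `T` is the set of the markers `e k` that lie before that position. The predicate
`lab` gives, for every position, the old state before that position and the old letter. -/
def Consistent (c : M) (δ : Set κ → Scan M → Scan M) (lab : Scan M × M → Fin n → Prop)
    (e : κ → Fin n) (y x u : Fin n) : Prop :=
  (∀ l, lab l y → δ {k | e k ≤ y} (l.1.step l.2) = l.1.step c) ∧
    (y < u → u < x → ∀ l, lab l u →
      (δ {k | e k < u} l.1).step l.2 = δ {k | e k ≤ u} (l.1.step l.2))

theorem Consistent.eq_scanTo {c : M} {δ : Set κ → Scan M → Scan M}
    {lab : Scan M × M → Fin n → Prop} {e : κ → Fin n} {y x : Fin n} {b : ℕ → M}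
    (hlab : ∀ l z, lab l z ↔ l = (scanTo b z, b z)) (hyx : y < x)
    (h : ∀ u, Consistent c δ lab e y x u) :
    δ {k | e k < x} (scanTo b x) = scanTo (Function.update b y c) x := by
  have key : ∀ i : ℕ, (y : ℕ) + 1 ≤ i → i ≤ x →
      δ {k | (e k : ℕ) < i} (scanTo b i) = scanTo (Function.update b y c) i := by
    intro i hyi
    induction i, hyi using Nat.le_induction with
    | base =>
      intro _
      have := (h y).1 _ ((hlab _ y).2 rfl)
      simp only [Nat.lt_succ_iff]
      rw [scanTo, scanTo, scanTo_update_of_le b le_rfl, Function.update_self]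
      exact this
    | succ i hyi ih =>
      intro hix
      have := (h ⟨i, by omega⟩).2 hyi hix _ ((hlab _ _).2 rfl)
      simp only [Nat.lt_succ_iff]
      rw [scanTo, scanTo, ← ih (by omega), Function.update_of_ne (by omega)]
      exact this.symm
  exact key x hyx le_rfl

/-- Markers for the events of the old and the new run after the changed position make it possible
to describe the new run by the old one. -/
theorem exists_consistent [Finite M] (c : M) {lab : Scan M × M → Fin n → Prop} (y : Fin n)
    {b : ℕ → M} (hlab : ∀ l z, lab l z ↔ l = (scanTo b z, b z)) :
    ∃ (e : (M × M) ⊕ M → Fin n) (δ : Set ((M × M) ⊕ M) → Scan M → Scan M),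
      ∀ x u, Consistent c δ lab e y x u := by
  classical
  set b' := Function.update b y c with hb'
  have hb : ∀ i, (y : ℕ) + 1 ≤ i → b' i = b i := fun i hi => Function.update_of_ne (by omega) _ _
  set r : ℕ → Scan M := fun i => scanTo b (y + 1 + i) with hr
  set r' : ℕ → Scan M := fun i => scanTo b' (y + 1 + i) with hr'
  have hrun : IsRun (fun i => b (y + 1 + i)) r := isRun_scanTo b _
  have hrun' : IsRun (fun i => b (y + 1 + i)) r' := by
    have := isRun_scanTo b' (y + 1)
    simpa only [hb _ (Nat.le_add_right _ _)] using this
  set E := Event (fun i => b (y + 1 + i)) r r' with hE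
  -- The letter number `i` after `y` has position `y + 1 + i`; an event at time `i` happens through
  -- the letter number `i - 1`. Events outside the word are marked at `y`, where they do no harm.
  let e (t : (M × M) ⊕ M) : Fin n :=
    if h : (y : ℕ) + sInf {i | E t i} < n then ⟨_, h⟩ else y
  have hdet : ∀ i k : ℕ, i ≤ k → (y : ℕ) + 1 + k ≤ n →
      {t | (e t : ℕ) < y + 1 + i} = {t | (e t : ℕ) < y + 1 + k} → r i = r k → r' i = r' k := by
    intro i k hik hk hT
    refine hrun.eq_of_no_event hrun' hik fun t ht => ?_
    have hmem : E t (sInf {i | E t i}) := Nat.sInf_mem (s := {i | E t i}) ⟨k, ht⟩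
    have hle : sInf {i | E t i} ≤ k := Nat.sInf_le ht
    have het : (e t : ℕ) = y + sInf {i | E t i} := by
      simp only [e]
      rw [dif_pos (by omega)]
    refine event_mono hrun hrun' t ?_ hmem
    have : t ∈ {t | (e t : ℕ) < y + 1 + i} := by
      rw [hT, Set.mem_ofPred_eq, het]
      omega
    rw [Set.mem_ofPred_eq, het] at this
    omega
  let Q (T : Set ((M × M) ⊕ M)) (q : Scan M) (i : ℕ) : Prop :=
    (y : ℕ) + 1 + i ≤ n ∧ {t | (e t : ℕ) < y + 1 + i} = T ∧ r i = q
  let δ (T : Set ((M × M) ⊕ M)) (q : Scan M) : Scan M :=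
    if h : ∃ i, Q T q i then r' h.choose else q
  have hδ : ∀ i : ℕ, (y : ℕ) + 1 + i ≤ n → δ {t | (e t : ℕ) < y + 1 + i} (r i) = r' i := by
    intro i hi
    have hex : ∃ k, Q {t | (e t : ℕ) < y + 1 + i} (r i) k := ⟨i, hi, rfl, rfl⟩
    obtain ⟨h₁, h₂, h₃⟩ := hex.choose_spec
    simp only [δ]
    rw [dif_pos hex]
    rcases le_total hex.choose i with hle | hle
    · exact hdet _ _ hle hi h₂ h₃
    · exact (hdet _ _ hle h₁ h₂.symm h₃.symm).symm
  refine ⟨e, δ, fun x u => ⟨fun l hl => ?_, fun hyu _ l hl => ?_⟩⟩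
  · obtain rfl := (hlab _ _).1 hl
    have := hδ 0 y.2
    simp only [add_zero, Nat.lt_succ_iff, hr, hr'] at this
    rw [scanTo, scanTo, hb', scanTo_update_of_le b le_rfl, Function.update_self] at this
    exact this
  · obtain rfl := (hlab _ _).1 hl
    obtain ⟨i, hi⟩ := Nat.exists_eq_add_of_le (show (y : ℕ) + 1 ≤ u from hyu)
    have h₀ := hδ i (by omega)
    have h₁ := hδ (i + 1) (by omega)
    simp only [← add_assoc, Nat.lt_succ_iff, hr, hr', ← hi] at h₀ h₁
    rw [scanTo, scanTo, ← h₀, hb _ (by omega)] at h₁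
    exact h₁.symm

end Change

/-! ### The dynamic program -/

/-- The auxiliary schema: the query bit and one unary relation for every label in `B`. -/
inductive AuxSym (B : Type) : ℕ → Type
  | query : AuxSym B 0
  | label (l : B) : AuxSym B 1

instance {B : Type} [Finite B] : Finite (Σ k, AuxSym B k) :=
  Finite.of_surjective (fun o : Option B => o.elim ⟨0, .query⟩ fun l => ⟨1, .label l⟩) <| by
    rintro ⟨_, _ | l⟩
    · exact ⟨none, rfl⟩
    · exact ⟨some l, rfl⟩

section Program

variable {α : Type u} {M : Type} [Monoid M] {n : ℕ}

/-- The labels of the positions that are stored in the auxiliary relations `A`. -/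
def labels {B : Type} (A : AuxInterp (AuxSym B) n) (l : B) (z : Fin n) : Prop :=
  A 1 (.label l) fun _ => z

/-- The condition under which the position `x` has the label `l` after the letter at position `y`
has been changed to `c`. -/
def NewLabel (c : M) (l : Scan M × M) (A : AuxInterp (AuxSym (Scan M × M)) n) (x y : Fin n) :
    Prop :=
  ∃ (e : (M × M) ⊕ M → Fin n) (δ : Set ((M × M) ⊕ M) → Scan M → Scan M), ∀ u : Fin n,
    (x < y ∧ labels A l x) ∨
    (x = y ∧ l.2 = c ∧ ∃ m, labels A (l.1, m) x) ∨
    (y < x ∧ Consistent c δ (labels A) e y x u ∧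
      ∃ q, labels A (q, l.2) x ∧ δ {k | e k < x} q = l.1)

/-- The condition under which the product of the word lies in `F` after the letter at position `y`
has been changed to `c`. The marker `e none` is the last position. -/
def NewQuery (F : Set M) (c : M) (A : AuxInterp (AuxSym (Scan M × M)) n) (y : Fin n) : Prop :=
  ∃ (e : Option ((M × M) ⊕ M) → Fin n) (δ : Set ((M × M) ⊕ M) → Scan M → Scan M), ∀ u : Fin n,
    u ≤ e none ∧
    ((e none = y ∧ ∃ l, labels A l y ∧ (l.1.step c).val ∈ F) ∨
    (y < e none ∧ Consistent c δ (labels A) (fun k => e (some k)) y (e none) u ∧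
      ∃ l, labels A l (e none) ∧ ((δ {k | e (some k) < e none} l.1).step l.2).val ∈ F))

theorem newLabel_iff [Finite M] {c : M} {l : Scan M × M} {A : AuxInterp (AuxSym (Scan M × M)) n}
    {x y : Fin n} {b : ℕ → M} (hA : ∀ l z, labels A l z ↔ l = (scanTo b z, b z)) :
    NewLabel c l A x y ↔
      l = (scanTo (Function.update b y c) x, Function.update b y c x) := by
  obtain ⟨q, m⟩ := l
  rcases lt_trichotomy x y with hxy | rfl | hxy
  · have hxy' : (x : ℕ) < y := hxy
    rw [scanTo_update_of_le b hxy'.le, Function.update_of_ne hxy'.ne, ← hA]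
    constructor
    · rintro ⟨e, δ, h⟩
      simpa [hxy, hxy.ne, hxy.not_gt] using h x
    · exact fun h => ⟨fun _ => x, fun _ q => q, fun u => Or.inl ⟨hxy, h⟩⟩
  · rw [scanTo_update_of_le b le_rfl, Function.update_self]
    constructor
    · rintro ⟨e, δ, h⟩
      have := h x
      simp only [lt_irrefl, false_and, true_and, or_false, false_or, hA, Prod.mk.injEq] at this
      obtain ⟨rfl, _, rfl, -⟩ := this
      rfl
    · rintro h
      obtain ⟨rfl, rfl⟩ := Prod.mk.inj h
      exact ⟨fun _ => x, fun _ q => q, fun u => Or.inr (Or.inl ⟨rfl, rfl, _, (hA _ _).2 rfl⟩)⟩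
  · have hxy' : (y : ℕ) < x := hxy
    rw [Function.update_of_ne hxy'.ne']
    constructor
    · rintro ⟨e, δ, h⟩
      simp only [hxy.not_gt, hxy.ne', hxy, false_and, true_and, false_or] at h
      obtain ⟨q', hq', hδ⟩ := (h x).2
      obtain ⟨rfl, rfl⟩ := Prod.mk.inj ((hA _ _).1 hq')
      rw [← Consistent.eq_scanTo hA hxy fun u => (h u).1, ← hδ]
    · rintro h
      obtain ⟨rfl, rfl⟩ := Prod.mk.inj h
      obtain ⟨e, δ, hcons⟩ := exists_consistent c y hA
      exact ⟨e, δ, fun u => Or.inr (Or.inr ⟨hxy, hcons x u, _, (hA _ _).2 rfl,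
        Consistent.eq_scanTo hA hxy (hcons x)⟩)⟩

theorem newQuery_iff [Finite M] {F : Set M} {c : M} {A : AuxInterp (AuxSym (Scan M × M)) n}
    {y : Fin n} {b : ℕ → M} (hA : ∀ l z, labels A l z ↔ l = (scanTo b z, b z)) :
    NewQuery F c A y ↔ (scanTo (Function.update b y c) n).val ∈ F := by
  obtain ⟨n, rfl⟩ : ∃ k, n = k + 1 := ⟨n - 1, by have := y.2; omega⟩
  have hlast : ∀ z : Fin (n + 1), (∀ u, u ≤ z) ↔ z = Fin.last n := fun z =>
    ⟨fun h => le_antisymm (Fin.le_last z) (h _), fun h u => h ▸ Fin.le_last u⟩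
  rw [scanTo]
  rcases eq_or_lt_of_le (Fin.le_last y) with rfl | hy
  · rw [Fin.val_last, scanTo_update_of_le b le_rfl, Function.update_self]
    constructor
    · rintro ⟨e, δ, h⟩
      have hz := (hlast _).1 fun u => (h u).1
      simp only [hz, lt_irrefl, false_and, true_and, or_false] at h
      obtain ⟨l, hl, hF⟩ := (h (Fin.last n)).2
      obtain rfl := (hA _ _).1 hl
      exact hF
    · exact fun hF => ⟨fun _ => Fin.last n, fun _ q => q, fun u =>
        ⟨Fin.le_last u, Or.inl ⟨rfl, _, (hA _ _).2 rfl, hF⟩⟩⟩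
  · have hy' : (y : ℕ) < n := hy
    rw [Function.update_of_ne hy'.ne']
    constructor
    · rintro ⟨e, δ, h⟩
      have hz := (hlast _).1 fun u => (h u).1
      simp only [hz, hy, hy.ne', false_and, true_and, false_or] at h
      obtain ⟨l, hl, hF⟩ := (h (Fin.last n)).2.2
      obtain rfl := (hA _ _).1 hl
      have := Consistent.eq_scanTo hA hy fun u => (h u).2.1
      rw [this] at hF
      exact hF
    · intro hF
      obtain ⟨e, δ, hcons⟩ := exists_consistent c y hA
      refine ⟨fun o => o.elim (Fin.last n) e, δ, fun u => ⟨Fin.le_last u, Or.inr ⟨hy,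
        hcons _ u, _, (hA _ _).2 rfl, ?_⟩⟩⟩
      have := Consistent.eq_scanTo hA hy (hcons (Fin.last n))
      simp only [Option.elim_some, Option.elim_none]
      rw [this]
      exact hF

namespace QFDefinable

variable {V κ B : Type} {Aux : ℕ → Type}

theorem labels (l : B) (a : V) : QFDefinable α
    fun n (A : AuxInterp (AuxSym B) n) (v : V → Fin n) => labels A l (v a) :=
  rel _ a

theorem markers_le [Finite κ] (e : κ → V) (a : V) (T : Set κ) : QFDefinable α
    fun n (_ : AuxInterp Aux n) (v : V → Fin n) => {k | v (e k) ≤ v a} = T :=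
  (forall_finite fun k => (le (e k) a).iff (const (k ∈ T))).congr fun _ _ _ => Set.ext_iff

theorem markers_lt [Finite κ] (e : κ → V) (a : V) (T : Set κ) : QFDefinable α
    fun n (_ : AuxInterp Aux n) (v : V → Fin n) => {k | v (e k) < v a} = T :=
  (forall_finite fun k => (lt (e k) a).iff (const (k ∈ T))).congr fun _ _ _ => Set.ext_iff

theorem consistent [Finite M] [Finite κ] (c : M) (δ : Set κ → Scan M → Scan M) (e : κ → V)
    (y x u : V) : QFDefinable α
      fun n (A : AuxInterp (AuxSym (Scan M × M)) n) (v : V → Fin n) =>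
        Consistent c δ (DynWord.labels A) (fun k => v (e k)) (v y) (v x) (v u) := by
  refine and (forall_finite fun l => (labels l y).imp ?_)
    ((lt y u).imp ((lt u x).imp (forall_finite fun l => (labels l u).imp ?_)))
  · exact subst (Ψ := fun T _ _ _ => δ T (l.1.step l.2) = l.1.step c) (markers_le e y)
      fun T => const _
  · exact subst (Ψ := fun T n _ v => (δ T l.1).step l.2 = δ {k | v (e k) ≤ v u} (l.1.step l.2))
      (markers_lt e u) fun T => subst
        (Ψ := fun T' _ _ _ => (δ T l.1).step l.2 = δ T' (l.1.step l.2)) (markers_le e u)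
        fun T' => const _

end QFDefinable

theorem sigma2Definable_newLabel [Finite M] (c : M) (l : Scan M × M) :
    Sigma2Definable α fun n (A : AuxInterp (AuxSym (Scan M × M)) n) (v : Fin 1 ⊕ Unit → Fin n) =>
      NewLabel c l A (v (.inl 0)) (v (.inr ())) := by
  let x : (Fin 1 ⊕ Unit) ⊕ ((M × M) ⊕ M) ⊕ Unit := .inl (.inl 0)
  let y : (Fin 1 ⊕ Unit) ⊕ ((M × M) ⊕ M) ⊕ Unit := .inl (.inr ())
  let e (k : (M × M) ⊕ M) : (Fin 1 ⊕ Unit) ⊕ ((M × M) ⊕ M) ⊕ Unit := .inr (.inl k)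
  let u : (Fin 1 ⊕ Unit) ⊕ ((M × M) ⊕ M) ⊕ Unit := .inr (.inr ())
  exact Sigma2Definable.exists_forall (κ := (M × M) ⊕ M)
    (ι := Set ((M × M) ⊕ M) → Scan M → Scan M)
    (Ψ := fun δ n A v =>
      (v x < v y ∧ labels A l (v x)) ∨
      (v x = v y ∧ l.2 = c ∧ ∃ m, labels A (l.1, m) (v x)) ∨
      (v y < v x ∧ Consistent c δ (labels A) (fun k => v (e k)) (v y) (v x) (v u) ∧
        ∃ q, labels A (q, l.2) (v x) ∧ δ {k | v (e k) < v x} q = l.1))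
    fun δ => ((QFDefinable.lt x y).and (.labels l x)).or
      (((QFDefinable.eq x y).and ((QFDefinable.const _).and
        (.exists_finite fun m => .labels (l.1, m) x))).or
      ((QFDefinable.lt y x).and ((QFDefinable.consistent c δ e y x u).and
        (.exists_finite fun q => (QFDefinable.labels (q, l.2) x).and
          (.subst (Ψ := fun T _ _ _ => δ T q = l.1) (.markers_lt e x) fun T => .const _)))))

theorem sigma2Definable_newQuery [Finite M] (F : Set M) (c : M) :
    Sigma2Definable α fun n (A : AuxInterp (AuxSym (Scan M × M)) n) (v : Fin 0 ⊕ Unit → Fin n) =>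
      NewQuery F c A (v (.inr ())) := by
  let y : (Fin 0 ⊕ Unit) ⊕ Option ((M × M) ⊕ M) ⊕ Unit := .inl (.inr ())
  let z : (Fin 0 ⊕ Unit) ⊕ Option ((M × M) ⊕ M) ⊕ Unit := .inr (.inl none)
  let e (k : (M × M) ⊕ M) : (Fin 0 ⊕ Unit) ⊕ Option ((M × M) ⊕ M) ⊕ Unit := .inr (.inl (some k))
  let u : (Fin 0 ⊕ Unit) ⊕ Option ((M × M) ⊕ M) ⊕ Unit := .inr (.inr ())
  exact Sigma2Definable.exists_forall (κ := Option ((M × M) ⊕ M))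
    (ι := Set ((M × M) ⊕ M) → Scan M → Scan M)
    (Ψ := fun δ n A v => v u ≤ v z ∧
      ((v z = v y ∧ ∃ l, labels A l (v y) ∧ (l.1.step c).val ∈ F) ∨
      (v y < v z ∧ Consistent c δ (labels A) (fun k => v (e k)) (v y) (v z) (v u) ∧
        ∃ l, labels A l (v z) ∧ ((δ {k | v (e k) < v z} l.1).step l.2).val ∈ F)))
    fun δ => (QFDefinable.le u z).and
      (((QFDefinable.eq z y).and
        (.exists_finite fun l => (QFDefinable.labels l y).and (.const _))).or
      ((QFDefinable.lt y z).and ((QFDefinable.consistent c δ e y z u).and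
        (.exists_finite fun l => (QFDefinable.labels l z).and
          (.subst (Ψ := fun T _ _ _ => ((δ T l.1).step l.2).val ∈ F) (.markers_lt e z)
            fun T => .const _)))))

/-- The letters of a word, evaluated in a monoid, and padded by `1`. -/
def letters (h : Option α → M) (w : Word α n) (i : ℕ) : M :=
  if hi : i < n then h (w ⟨i, hi⟩) else 1

theorem letters_none {h : Option α → M} (h₁ : h none = 1) :
    letters h (fun _ : Fin n => none) = fun _ => 1 := by
  funext i
  simp [letters, h₁]

theorem letters_update (h : Option α → M) (w : Word α n) (y : Fin n) (c : Option α) :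
    letters h (Function.update w y c) = Function.update (letters h w) y (h c) := by
  funext i
  by_cases hi : i = y
  · subst hi
    simp [letters]
  · rw [Function.update_of_ne hi]
    simp only [letters]
    split_ifs with hin
    · rw [Function.update_of_ne fun he => hi (congrArg Fin.val he)]
    · rfl

theorem prodTo_eq_prod (b : ℕ → M) (n : ℕ) : prodTo b n = (List.ofFn fun i : Fin n => b i).prod := by
  induction n with
  | zero => rfl
  | succ n ih => rw [prodTo, ih, List.ofFn_succ', List.prod_concat]; rfl

theorem prod_map_reduceOption {h : Option α → M} (h₁ : h none = 1) (t : List (Option α)) :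
    (t.reduceOption.map fun a => h (some a)).prod = (t.map h).prod := by
  induction t with
  | nil => rfl
  | cons o t ih =>
    cases o with
    | none => simp [h₁, ih]
    | some a => simp [ih]

theorem val_scanTo_letters {h : Option α → M} (h₁ : h none = 1) (w : Word α n) :
    (scanTo (letters h w) n).val = (w.toList.map fun a => h (some a)).prod := by
  rw [val_scanTo, prodTo_eq_prod, Word.toList, prod_map_reduceOption h₁, List.map_ofFn]
  congr 2
  funext i
  simp [letters]

open FirstOrder FirstOrder.Language in
/-- The program that stores, for every position, the state of the scanning automaton before that
position and the letter of that position. -/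
theorem exists_dynProgram [Finite M] (h : Option α → M) (h₁ : h none = 1) (F : Set M) :
    ∃ P : DynProgram α, P.AtMostUnary ∧ P.UpdatesSigma2 ∧
      P.Maintains {t | (t.map fun a => h (some a)).prod ∈ F} := by
  classical
  choose φ hφ hφ' using fun (c : Option α) (l : Scan M × M) =>
    sigma2Definable_newLabel (α := α) (h c) l
  choose χ hχ hχ' using fun c : Option α => sigma2Definable_newQuery (α := α) F (h c)
  let P : DynProgram α :=
    { Aux := AuxSym (Scan M × M)
      finite_aux := inferInstance
      query := .query
      init := fun R => match R with
        | .query => if (1 : M) ∈ F then ⊤ else ⊥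
        | .label l => if l = (Scan.start, 1) then ⊤ else ⊥
      update := fun c R => match R with
        | .query => χ c
        | .label l => φ c l }
  refine ⟨P, ?_, ?_, ?_⟩
  · rintro k hk
    refine ⟨fun R => ?_⟩
    cases R <;> omega
  · rintro k c (_ | l)
    · exact hχ c
    · exact hφ c l
  · have hstep : ∀ {n : ℕ} (cs : List (Option α × Fin n)) (s : P.State n),
        ((∀ l z, labels s.aux l z ↔ l = (scanTo (letters h s.word) z, letters h s.word z)) ∧
          (s.aux 0 .query Fin.elim0 ↔ (scanTo (letters h s.word) n).val ∈ F)) →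
        ((cs.foldl P.step s).aux 0 .query Fin.elim0 ↔
          (scanTo (letters h (cs.foldl P.step s).word) n).val ∈ F) := by
      intro n cs
      induction cs with
      | nil => exact fun s hs => hs.2
      | cons c cs ih =>
        refine fun s hs => ih _ ⟨fun l z => ?_, ?_⟩
        · refine (hφ' c.1 l n _ s.aux (Sum.elim (fun _ => z) fun _ => c.2)).trans ?_
          refine (newLabel_iff hs.1).trans ?_
          rw [← letters_update]
          rfl
        · refine (hχ' c.1 n _ s.aux (Sum.elim Fin.elim0 fun _ => c.2)).trans ?_
          refine (newQuery_iff hs.1).trans ?_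
          rw [← letters_update]
          rfl
    intro n cs
    refine (hstep cs (P.initial n) ⟨fun l z => ?_, ?_⟩).trans ?_
    · change @Formula.Realize (inputSchema α) (Fin n) (inputStructure fun _ => none) _
        (if l = (Scan.start, 1) then ⊤ else ⊥) _ ↔ l = (scanTo (letters h fun _ => none) z,
          letters h (fun _ : Fin n => none) z)
      rw [letters_none h₁, scanTo_one]
      let _ := inputStructure (α := α) (fun _ : Fin n => none)
      split_ifs with hl <;> simp [hl]
    · change @Formula.Realize (inputSchema α) (Fin n) (inputStructure fun _ => none) _
        (if (1 : M) ∈ F then ⊤ else ⊥) _ ↔ (scanTo (letters h fun _ : Fin n => none) n).val ∈ F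
      rw [letters_none h₁, scanTo_one]
      let _ := inputStructure (α := α) (fun _ : Fin n => none)
      change _ ↔ (1 : M) ∈ F
      split_ifs with hF <;> simp [hF]
    · rw [val_scanTo_letters h₁]
      rfl

end Program

/-- The transition monoid acts from the right, hence the opposite of `Function.End`. -/
theorem unop_prod_map_step {α : Type*} {σ : Type*} (D : DFA α σ) (t : List α) (s : σ) :
    (t.map fun a => MulOpposite.op (show Function.End σ from fun s => D.step s a)).prod.unop s =
      D.evalFrom s t := by
  induction t generalizing s with
  | nil => rfl
  | cons a t ih =>
    rw [List.map_cons, List.prod_cons, MulOpposite.unop_mul, DFA.evalFrom_cons, ← ih]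
    rfl

end DynWord

theorem theorem1 {α : Type u} [Finite α] (L : Language α) (hL : L.IsRegular) :
    L ∈ DynWord.UDynSigma2 α := by
  obtain ⟨σ, _, D, rfl⟩ := hL
  have : Finite (Function.End σ)ᵐᵒᵖ := Finite.of_equiv (σ → σ) MulOpposite.opEquiv
  obtain ⟨P, hP₁, hP₂, hP⟩ := DynWord.exists_dynProgram
    (fun o : Option α => o.elim 1 fun a =>
      MulOpposite.op (show Function.End σ from fun s => D.step s a)) rfl
    {f | f.unop D.start ∈ D.accept}
  refine ⟨P, hP₁, hP₂, fun n cs => (hP n cs).trans ?_⟩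
  simp only [DFA.mem_accepts, DFA.eval, ← DynWord.unop_prod_map_step]
  rfl
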